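/- Let $(\Sigma,I)$ be an independence alphabet, i.e. $\Sigma$ is a finite set and $I\subseteq\Sigma\times\Sigma$ is an irreflexive symmetric relation. Let $M(\Sigma,I)=\Sigma^*/\{ab=ba\mid (a,b)\in I\}$ be its trace monoid and let $C(\Sigma,I)$ be the right-angled Coxeter group with generating set $\Sigma$ and defining relations $a^2=1$ for $a\in\Sigma$ and $ab=ba$ for $(a,b)\in I$. A trace $u\in M(\Sigma,I)$ is called a Coxeter-trace if it has no factor $a^2$ with $a\in\Sigma$. Every element of $C(\Sigma,I)$ is represented by exactly one Coxeter-trace; for $w\in\Sigma^*$ let $\widehat w$ be the Coxeter-trace with $w=\widehat w$ in $C(\Sigma,I)$, and let $\widehat\alpha(w)\subseteq\Sigma$ be the set of letters that occur in $\widehat w$. Then, for the fixed group $C(\Sigma,I)$, the set $\widehat\alpha(w)$ can be computed in logspace on input $w\in\Sigma^*$. That is, for every finite alphabet $\Omega$ and every encoding $\mathrm{enc}\colon 2^{\Sigma}\to\Omega^*$ of the subsets of $\Sigma$ by words, there is a deterministic Turing machine with a read-only input tape, a read/write work tape and a write-only output tape (written from left to right) which on every input $w\in\Sigma^*$ halts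 with output $\mathrm{enc}(\widehat\alpha(w))$ and uses at most $k(\lfloor\log_2 |w|\rfloor+1)$ cells of its work tape, where $\log_2 0$ is read as $0$ and the constant $k$ does not depend on $w$. -/

import Mathlib

/-! ### Deterministic logspace transducers -/

/-- What the input head can scan: the left end marker, the right end marker, or an input letter. -/
inductive TapeCell (A : Type*) where
  | leftEnd : TapeCell A
  | rightEnd : TapeCell A
  | letter (a : A) : TapeCell A

/-- A head movement: one cell to the left, stay, or one cell to the right. -/
inductive HeadMove where
  | left : HeadMove
  | stay : HeadMove
  | right : HeadMove

/-- The effect of one step of a transducer: the new state, the symbol written on the scanned cell of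
the work tape, the moves of the input head and of the work head, and possibly one letter that is
appended to the output. -/
structure TransducerAction (B Q Γ : Type*) where
  state : Q
  write : Γ
  inputMove : HeadMove
  workMove : HeadMove
  emit : Option B

/-- A deterministic Turing machine with three tapes: a read-only input tape over `A` (with end
markers), a read/write work tape, and a write-only output tape over `B`. The value `none` of the
transition function means that the machine halts. -/
structure Transducer (A B : Type*) where
  State : Type
  WorkSymbol : Type
  finiteState : Finite State
  finiteWorkSymbol : Finite WorkSymbol
  start : State
  blank : WorkSymbol
  transition : State → TapeCell A → WorkSymbol → Option (TransducerAction B State WorkSymbol)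

namespace Transducer

variable {A B : Type*}

/-- A configuration. The input head is at a position between `0` (left end marker) and
`|w| + 1` (right end marker); position `i + 1` holds the letter of `w` with index `i`. The cells of
the one-sided infinite work tape are numbered `0, 1, 2, …`. -/
@[ext]
structure Config (M : Transducer A B) where
  state : M.State
  inputPos : ℕ
  work : ℕ → M.WorkSymbol
  workPos : ℕ
  output : List B

/-- The content of the input tape at a position. -/
def cellAt (w : List A) : ℕ → TapeCell A
  | 0 => .leftEnd
  | i + 1 =>
    match w[i]? with
    | some a => .letter a
    | none => .rightEnd

/-- The input head never leaves the positions `0, …, n + 1`, where `n` is the input length. -/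
def moveInput (n : ℕ) : HeadMove → ℕ → ℕ
  | .left, p => p - 1
  | .stay, p => p
  | .right, p => min (p + 1) (n + 1)

/-- The work head stays where it is when it is told to move left from cell `0`. -/
def moveWork : HeadMove → ℕ → ℕ
  | .left, p => p - 1
  | .stay, p => p
  | .right, p => p + 1

/-- The initial configuration: both heads at position `0`, blank work tape, empty output. -/
def init (M : Transducer A B) : Config M where
  state := M.start
  inputPos := 0
  work := fun _ => M.blank
  workPos := 0
  output := []

/-- One step of `M` on input `w`; `none` if the machine halts. -/
def step (M : Transducer A B) (w : List A) (c : Config M) : Option (Config M) :=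
  (M.transition c.state (cellAt w c.inputPos) (c.work c.workPos)).map fun act =>
    { state := act.state
      inputPos := moveInput w.length act.inputMove c.inputPos
      work := Function.update c.work c.workPos act.write
      workPos := moveWork act.workMove c.workPos
      output := c.output ++ act.emit.toList }

/-- `M.Reaches w c`: on input `w` the machine passes through the configuration `c`. -/
def Reaches (M : Transducer A B) (w : List A) (c : Config M) : Prop :=
  Relation.ReflTransGen (fun c₁ c₂ => M.step w c₁ = some c₂) M.init c

/-- On every input `w` the machine halts with output `f w`. -/
def Computes (M : Transducer A B) (f : List A → List B) : Prop :=
  ∀ w : List A, ∃ c : Config M, M.Reaches w c ∧ M.step w c = none ∧ c.output = f w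

/-- On every input of length `n` the machine uses only the first `s n` cells of its work tape. -/
def UsesSpace (M : Transducer A B) (s : ℕ → ℕ) : Prop :=
  ∀ (w : List A) (c : Config M), M.Reaches w c → c.workPos < s w.length

end Transducer

/-- A function between words over finite alphabets is computable in logspace if some transducer
computes it within `O(log n)` work tape cells on inputs of length `n`. (The summand `1` makes the
bound meaningful for `n ≤ 1`.) -/
def LogspaceComputable {A B : Type*} (f : List A → List B) : Prop :=
  ∃ (M : Transducer A B) (k : ℕ),
    M.Computes f ∧ M.UsesSpace fun n => k * (Nat.log 2 n + 1)

/-! ### Traces and right-angled Coxeter groups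

An independence alphabet is a finite type `A` with an irreflexive and symmetric relation, that is, a
simple graph `I` on `A`. -/

/-- The defining relations `ab = ba`, for `(a, b) ∈ I`, of the trace monoid. -/
def commRel {A : Type*} (I : SimpleGraph A) (x y : FreeMonoid A) : Prop :=
  ∃ a b : A, I.Adj a b ∧ x = FreeMonoid.of a * FreeMonoid.of b ∧
    y = FreeMonoid.of b * FreeMonoid.of a

/-- The trace monoid `M(A, I)`. -/
abbrev TraceMonoid {A : Type*} (I : SimpleGraph A) : Type _ := PresentedMonoid (commRel I)

/-- The trace represented by a word. -/
def traceOfWord {A : Type*} (I : SimpleGraph A) (w : List A) : TraceMonoid I :=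
  PresentedMonoid.mk (commRel I) (FreeMonoid.ofList w)

/-- A trace `u` is a factor of a trace `v` if `v = x u y` for some traces `x`, `y`. -/
def IsTraceFactor {A : Type*} {I : SimpleGraph A} (u v : TraceMonoid I) : Prop :=
  ∃ x y : TraceMonoid I, v = x * u * y

open Classical in
/-- The alphabet of a trace: the letters that occur in it (that is, in a word representing it). -/
noncomputable def traceAlphabet {A : Type*} [Fintype A] {I : SimpleGraph A} (u : TraceMonoid I) :
    Finset A :=
  Finset.univ.filter fun a => ∃ w : List A, traceOfWord I w = u ∧ a ∈ w

/-- A Coxeter-trace is a trace without a factor `a²`, where `a` is a letter. -/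
def IsCoxeterTrace {A : Type*} {I : SimpleGraph A} (u : TraceMonoid I) : Prop :=
  ∀ a : A, ¬ IsTraceFactor (traceOfWord I [a, a]) u

open Classical in
/-- The right-angled Coxeter matrix of `I`: the entry is `1` on the diagonal, `2` if `(a, b) ∈ I`,
and `0` (no relation) otherwise. -/
noncomputable def rightAngledMatrix {A : Type*} (I : SimpleGraph A) : CoxeterMatrix A where
  M := Matrix.of fun a b => if a = b then 1 else if I.Adj a b then 2 else 0
  isSymm := by
    ext a b
    simp [Matrix.transpose_apply, eq_comm, I.adj_comm]
  diagonal a := by simp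
  off_diagonal a b h := by
    by_cases hab : I.Adj a b <;> simp [h, hab]

/-- The right-angled Coxeter group `C(A, I)`: generators `A`, relations `a² = 1` for all `a` and
`(ab)² = 1` (equivalently `ab = ba`) for `(a, b) ∈ I`. -/
abbrev RightAngledCoxeterGroup {A : Type*} (I : SimpleGraph A) : Type _ :=
  (rightAngledMatrix I).Group

theorem simple_comm_of_adj {A : Type*} (I : SimpleGraph A) {a b : A} (h : I.Adj a b) :
    (rightAngledMatrix I).simple a * (rightAngledMatrix I).simple b =
      (rightAngledMatrix I).simple b * (rightAngledMatrix I).simple a := by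
  have h1 := (rightAngledMatrix I).toCoxeterSystem.simple_mul_simple_pow a b
  have h2 : rightAngledMatrix I a b = 2 := by
    simp [rightAngledMatrix, h, h.ne]
  have ha := (rightAngledMatrix I).toCoxeterSystem.inv_simple a
  have hb := (rightAngledMatrix I).toCoxeterSystem.inv_simple b
  simp only [CoxeterMatrix.toCoxeterSystem_simple] at h1 ha hb
  rw [h2, pow_two] at h1
  have h3 := eq_inv_of_mul_eq_one_left h1
  rwa [mul_inv_rev, ha, hb] at h3

/-- The canonical homomorphism from `M(A, I)` to `C(A, I)`, which is the identity on letters. -/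
noncomputable def traceToCoxeter {A : Type*} (I : SimpleGraph A) :
    TraceMonoid I →* RightAngledCoxeterGroup I :=
  PresentedMonoid.lift (rightAngledMatrix I).simple <| by
    rintro _ _ ⟨a, b, h, rfl, rfl⟩
    simpa using simple_comm_of_adj I h

/-- The Coxeter-trace that represents the group element `g`. -/
noncomputable def coxeterTrace {A : Type*} (I : SimpleGraph A) (g : RightAngledCoxeterGroup I) :
    TraceMonoid I :=
  Classical.epsilon fun u : TraceMonoid I => IsCoxeterTrace u ∧ traceToCoxeter I u = g

/-- The alphabet of the Coxeter-trace of the group element represented by the word `w`. -/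
noncomputable def reducedAlphabet {A : Type*} [Fintype A] (I : SimpleGraph A) (w : List A) :
    Finset A :=
  traceAlphabet (coxeterTrace I (traceToCoxeter I (traceOfWord I w)))

/-! ### Words, traces and group elements -/

section Words

variable {A : Type*} (I : SimpleGraph A)

/-! The group acts on `A → ℤ` by affine reflections. The vector `x` stands for the weight `ρ - ∑ x b
• α b`, where the form on the simple roots is `2` on the diagonal, `0` for commuting letters and
`-2` for all other pairs; `increment I a x` is the pairing of this weight with `α a`. At the origin
all increments are `1`, and every increment is odd, so its sign is defined. If the increment at `a`
is negative at the position of a Coxeter-trace, then the trace can begin with `a`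
(`IsCoxeterTrace.increment_dichotomy`). Hence along a Coxeter-trace each reflection strictly raises
its own coordinate. The orbit of the origin therefore determines the Coxeter-trace, which gives
uniqueness, and the letters of the trace are those with a nonzero coordinate
(`mem_reducedAlphabet_iff`).

For `n` letters over an alphabet of size `d` the coordinates are below `(2d+2)^n` in absolute value,
too large to be stored. But a nonzero integer of absolute value below `2^h` fails to be divisible by
some `m ≤ 2h`, because divisibility by all of them forces divisibility by the central binomial
coefficient (`exists_not_dvd_of_lt_two_pow`). So it suffices to compute the position modulo every `m
≤ (4d+4)n`, in registers of `O(log n)` bits.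

The machine is written as a program that tests and assigns integer linear forms in finitely many
registers. `RegProgram.logspaceComputable` compiles it: the registers lie on parallel binary tracks,
and one sweep evaluates a form with a bounded carry kept in the finite control. -/

theorem traceOfWord_append (v w : List A) :
    traceOfWord I (v ++ w) = traceOfWord I v * traceOfWord I w := by
  simp [traceOfWord]

theorem traceOfWord_cons (a : A) (w : List A) :
    traceOfWord I (a :: w) = traceOfWord I [a] * traceOfWord I w :=
  traceOfWord_append I [a] w

theorem traceOfWord_surjective : Function.Surjective (traceOfWord I) := fun u => by
  obtain ⟨w, rfl⟩ := PresentedMonoid.surjective_mk u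
  exact ⟨FreeMonoid.toList w, rfl⟩

theorem traceOfWord_swap {a b : A} (h : I.Adj a b) (w : List A) :
    traceOfWord I (a :: b :: w) = traceOfWord I (b :: a :: w) := by
  have : traceOfWord I [a, b] = traceOfWord I [b, a] :=
    PresentedMonoid.mk_eq_mk_of_rel ⟨a, b, h, rfl, rfl⟩
  have h2 := congrArg (· * traceOfWord I w) this
  simpa only [← traceOfWord_append, List.cons_append, List.nil_append] using h2

theorem traceToCoxeter_traceOfWord (w : List A) :
    traceToCoxeter I (traceOfWord I w) = (rightAngledMatrix I).toCoxeterSystem.wordProd w := by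
  induction w with
  | nil => exact map_one _
  | cons a w ih =>
    rw [traceOfWord_cons, map_mul, ih, CoxeterSystem.wordProd_cons]
    rfl

theorem IsCoxeterTrace.of_cons {a : A} {w : List A}
    (h : IsCoxeterTrace (traceOfWord I (a :: w))) : IsCoxeterTrace (traceOfWord I w) := by
  rintro b ⟨x, y, hxy⟩
  exact h b ⟨traceOfWord I [a] * x, y, by rw [traceOfWord_cons, hxy]; simp only [mul_assoc]⟩

theorem not_isCoxeterTrace_cons_cons (a : A) (w : List A) :
    ¬ IsCoxeterTrace (traceOfWord I (a :: a :: w)) := fun h =>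
  h a ⟨1, traceOfWord I w, by rw [one_mul, ← traceOfWord_append]; rfl⟩

/-- The length of a trace, as a homomorphism. -/
def traceLength : TraceMonoid I →* Multiplicative ℕ :=
  PresentedMonoid.lift (fun _ => Multiplicative.ofAdd 1) <| by
    rintro _ _ ⟨a, b, -, rfl, rfl⟩; simp

theorem traceLength_traceOfWord (w : List A) :
    traceLength I (traceOfWord I w) = Multiplicative.ofAdd w.length := by
  induction w with
  | nil => exact map_one _
  | cons a w ih =>
    rw [traceOfWord_cons, map_mul, ih, List.length_cons, add_comm, ofAdd_add]
    rfl

theorem length_eq_of_traceOfWord_eq {v w : List A} (h : traceOfWord I v = traceOfWord I w) :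
    v.length = w.length := by
  have := congrArg (traceLength I) h
  rwa [traceLength_traceOfWord, traceLength_traceOfWord] at this

/-- Cancelling a factor `a²` keeps the group element and shortens the word by two. -/
theorem exists_isCoxeterTrace (w : List A) : ∃ v, IsCoxeterTrace (traceOfWord I v) ∧
    (rightAngledMatrix I).toCoxeterSystem.wordProd v =
      (rightAngledMatrix I).toCoxeterSystem.wordProd w := by
  induction hn : w.length using Nat.strong_induction_on generalizing w with
  | _ n ih =>
    by_cases hw : IsCoxeterTrace (traceOfWord I w)
    · exact ⟨w, hw, rfl⟩
    simp only [IsCoxeterTrace, not_forall, not_not] at hw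
    obtain ⟨a, x, y, hxy⟩ := hw
    obtain ⟨p, rfl⟩ := traceOfWord_surjective I x
    obtain ⟨s, rfl⟩ := traceOfWord_surjective I y
    rw [← traceOfWord_append, ← traceOfWord_append] at hxy
    have hlen := length_eq_of_traceOfWord_eq I hxy
    simp only [List.length_append, List.length_cons, List.length_nil] at hlen
    obtain ⟨v, hv, hvw⟩ := ih (p ++ s).length (by rw [List.length_append]; omega) _ rfl
    refine ⟨v, hv, ?_⟩
    rw [hvw, ← traceToCoxeter_traceOfWord I w, hxy, traceToCoxeter_traceOfWord]
    simp only [CoxeterSystem.wordProd_append, CoxeterSystem.wordProd_cons,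
      CoxeterSystem.wordProd_nil, mul_one, mul_assoc]
    rw [CoxeterSystem.simple_mul_simple_cancel_left]

end Words

/-! ### The number game of a right-angled Coxeter group -/

section NumberGame

variable {A : Type*} (I : SimpleGraph A)

open Classical in
/-- The off-diagonal part of the bilinear form: `2` for distinct letters that do not commute. -/
noncomputable def depCoeff (a b : A) : ℤ := if b = a ∨ I.Adj a b then 0 else 2

theorem depCoeff_self (a : A) : depCoeff I a a = 0 := by simp [depCoeff]

theorem depCoeff_of_adj {a b : A} (h : I.Adj a b) : depCoeff I a b = 0 := by simp [depCoeff, h]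

theorem depCoeff_of_not_adj {a b : A} (hne : a ≠ b) (h : ¬ I.Adj a b) : depCoeff I a b = 2 := by
  simp [depCoeff, h, hne.symm]

theorem depCoeff_nonneg (a b : A) : 0 ≤ depCoeff I a b := by unfold depCoeff; split_ifs <;> simp

theorem depCoeff_le_two (a b : A) : depCoeff I a b ≤ 2 := by unfold depCoeff; split_ifs <;> simp

variable [Fintype A]

/-- The increment of the coordinate at `a` under the reflection at `a`. -/
noncomputable def increment (a : A) (x : A → ℤ) : ℤ :=
  1 - 2 * x a + ∑ b, depCoeff I a b * x b

open Classical in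
/-- The affine reflection at `a`. -/
noncomputable def reflect (a : A) (x : A → ℤ) : A → ℤ :=
  Function.update x a (x a + increment I a x)

theorem reflect_same (a : A) (x : A → ℤ) : reflect I a x a = x a + increment I a x := by
  simp [reflect]

theorem reflect_of_ne {a b : A} (h : b ≠ a) (x : A → ℤ) : reflect I a x b = x b := by
  simp [reflect, h]

theorem sum_depCoeff_reflect (a c : A) (x : A → ℤ) :
    ∑ b, depCoeff I a b * reflect I c x b =
      ∑ b, depCoeff I a b * x b + depCoeff I a c * increment I c x := by
  classical
  have : ∀ b, depCoeff I a b * reflect I c x b =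
      depCoeff I a b * x b + if b = c then depCoeff I a c * increment I c x else 0 := by
    intro b
    split_ifs with h
    · subst h; rw [reflect_same]; ring
    · rw [reflect_of_ne I h]; ring
  simp only [this, Finset.sum_add_distrib, Finset.sum_ite_eq', Finset.mem_univ, if_true]

theorem increment_reflect_same (a : A) (x : A → ℤ) :
    increment I a (reflect I a x) = - increment I a x := by
  rw [increment, sum_depCoeff_reflect, reflect_same, depCoeff_self, increment]; ring

theorem increment_reflect_of_ne {a c : A} (h : a ≠ c) (x : A → ℤ) :
    increment I a (reflect I c x) = increment I a x + depCoeff I a c * increment I c x := by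
  rw [increment, sum_depCoeff_reflect, reflect_of_ne I h]; unfold increment; ring

/-- All entries of `depCoeff` are even, so increments are odd. -/
theorem increment_ne_zero (a : A) (x : A → ℤ) : increment I a x ≠ 0 := by
  have : Even (∑ b, depCoeff I a b * x b) := by
    refine Finset.even_sum _ fun b _ => Even.mul_right ?_ _
    unfold depCoeff; split_ifs <;> simp
  obtain ⟨k, hk⟩ := this
  rw [increment, hk]; omega

theorem reflect_reflect (a : A) (x : A → ℤ) : reflect I a (reflect I a x) = x := by
  funext b
  by_cases h : b = a
  · subst h; rw [reflect_same, increment_reflect_same, reflect_same]; ring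
  · rw [reflect_of_ne I h, reflect_of_ne I h]

theorem reflect_comm {a b : A} (h : I.Adj a b) (x : A → ℤ) :
    reflect I a (reflect I b x) = reflect I b (reflect I a x) := by
  have hab := h.ne
  have key : ∀ {a b : A}, I.Adj a b → reflect I a (reflect I b x) a = reflect I a x a := by
    intro a b h
    rw [reflect_same, increment_reflect_of_ne I h.ne, depCoeff_of_adj I h, reflect_same,
      reflect_of_ne I h.ne]
    ring
  funext c
  by_cases hca : c = a
  · subst hca; rw [key h, reflect_of_ne I hab]
  by_cases hcb : c = b
  · subst hcb; rw [key h.symm, reflect_of_ne I hca]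
  · simp only [reflect_of_ne I hca, reflect_of_ne I hcb]

/-- The action of the Coxeter group by affine reflections. -/
noncomputable def affineAction : RightAngledCoxeterGroup I →* Function.End (A → ℤ) :=
  (rightAngledMatrix I).toCoxeterSystem.lift ⟨fun a => reflect I a, by
    intro a b
    by_cases hab : a = b
    · subst hab
      have h : (rightAngledMatrix I).M a a = 1 := by simp
      rw [h, pow_one]
      funext x; exact reflect_reflect I a x
    by_cases h : I.Adj a b
    · have h2 : (rightAngledMatrix I).M a b = 2 := by simp [rightAngledMatrix, h, hab]
      rw [h2, pow_two]
      funext x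
      change reflect I a (reflect I b (reflect I a (reflect I b x))) = x
      rw [reflect_comm I h, reflect_reflect, reflect_reflect]
    · have h2 : (rightAngledMatrix I).M a b = 0 := by simp [rightAngledMatrix, h, hab]
      rw [h2, pow_zero]⟩

theorem affineAction_simple (a : A) :
    affineAction I ((rightAngledMatrix I).toCoxeterSystem.simple a) = reflect I a :=
  CoxeterSystem.lift_apply_simple _ _ a

/-- The image of the origin under the group element represented by a word. -/
noncomputable def position (w : List A) : A → ℤ := w.foldr (reflect I) 0

theorem position_cons (a : A) (w : List A) :
    position I (a :: w) = reflect I a (position I w) := rfl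

theorem position_eq (w : List A) :
    position I w = affineAction I ((rightAngledMatrix I).toCoxeterSystem.wordProd w) 0 := by
  induction w with
  | nil => rw [CoxeterSystem.wordProd_nil, map_one]; rfl
  | cons a w ih =>
    rw [position_cons, ih, CoxeterSystem.wordProd_cons, map_mul]
    exact congrFun (affineAction_simple I a).symm _

/-! ### Signs of increments along a Coxeter-trace -/

theorem increment_position_nil (a : A) : increment I a (position I []) = 1 := by
  simp [increment, position]

/-- The first clause says that two dependent letters never have negative increments together; it is
the invariant that carries the induction for the second. A reflection at `c` with increment `p > 0`
turns `p` into `-p`, adds `2p` at letters dependent on `c`, and changes nothing else. -/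
theorem IsCoxeterTrace.increment_dichotomy {w : List A} (hw : IsCoxeterTrace (traceOfWord I w)) :
    (∀ a b, a ≠ b → ¬ I.Adj a b →
      0 < increment I a (position I w) + increment I b (position I w)) ∧
    ∀ a, increment I a (position I w) < 0 →
      ∃ w', traceOfWord I w = traceOfWord I (a :: w') := by
  induction w with
  | nil => simp [increment_position_nil]
  | cons c w ih =>
    obtain ⟨hpair, hdesc⟩ := ih hw.of_cons
    -- A negative increment would let `w` begin with `c`, giving a factor `c²`.
    have hc : 0 < increment I c (position I w) := by
      rcases lt_or_gt_of_ne (increment_ne_zero I c (position I w)) with h | h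
      · obtain ⟨w', hw'⟩ := hdesc c h
        rw [traceOfWord_cons, hw', ← traceOfWord_cons] at hw
        exact absurd hw (not_isCoxeterTrace_cons_cons I c w')
      · exact h
    have hmono : ∀ a, a ≠ c → increment I a (position I w) ≤
        increment I a (position I (c :: w)) := by
      intro a ha
      rw [position_cons, increment_reflect_of_ne I ha]
      have := depCoeff_nonneg I a c
      nlinarith
    -- The sum at a dependent pair is preserved: `(q + 2p) + (-p) = q + p`.
    have hcpair : ∀ a, a ≠ c → ¬ I.Adj a c → 0 < increment I a (position I (c :: w)) +
        increment I c (position I (c :: w)) := by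
      intro a ha hac
      rw [position_cons, increment_reflect_of_ne I ha, increment_reflect_same,
        depCoeff_of_not_adj I ha hac]
      linarith [hpair a c ha hac]
    refine ⟨fun a b hab hadj => ?_, fun a ha => ?_⟩
    · by_cases hac : a = c
      · subst hac
        rw [add_comm]
        exact hcpair b hab.symm fun h => hadj h.symm
      by_cases hbc : b = c
      · subst hbc; exact hcpair a hab hadj
      · linarith [hpair a b hab hadj, hmono a hac, hmono b hbc]
    · by_cases hac : a = c
      · subst hac; exact ⟨w, rfl⟩
      by_cases hadj : I.Adj a c
      · obtain ⟨w', hw'⟩ := hdesc a (lt_of_le_of_lt (hmono a hac) ha)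
        refine ⟨c :: w', ?_⟩
        rw [traceOfWord_cons, hw', ← traceOfWord_cons, traceOfWord_swap I hadj.symm]
      -- If `a` depends on `c`, both increments would be negative after the reflection, against the
      -- first clause.
      · have h1 := hcpair a hac hadj
        have h2 : increment I c (position I (c :: w)) < 0 := by
          rw [position_cons, increment_reflect_same]; linarith
        linarith

theorem IsCoxeterTrace.increment_pos {a : A} {w : List A}
    (hw : IsCoxeterTrace (traceOfWord I (a :: w))) : 0 < increment I a (position I w) := by
  rcases lt_or_gt_of_ne (increment_ne_zero I a (position I w)) with h | h
  · obtain ⟨w', hw'⟩ := (hw.of_cons.increment_dichotomy I).2 a h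
    rw [traceOfWord_cons, hw', ← traceOfWord_cons] at hw
    exact absurd hw (not_isCoxeterTrace_cons_cons I a w')
  · exact h

theorem IsCoxeterTrace.position_support {w : List A} (hw : IsCoxeterTrace (traceOfWord I w))
    (a : A) : 0 ≤ position I w a ∧ (position I w a ≠ 0 ↔ a ∈ w) := by
  induction w with
  | nil => simp [position]
  | cons c w ih =>
    have hc := hw.increment_pos I
    obtain ⟨h0, h1⟩ := ih hw.of_cons
    by_cases hac : a = c
    · subst hac
      rw [position_cons, reflect_same]
      simp only [List.mem_cons, true_or, iff_true]
      constructor <;> linarith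
    · rw [position_cons, reflect_of_ne I hac]
      simp [hac, h0, h1]

/-- The common position has a negative increment at the first letter of `v`, so `w` can begin with
that letter too and it cancels. If `v` is empty, all increments are `1`, which excludes a first
letter of `w`. -/
theorem IsCoxeterTrace.eq_of_wordProd_eq {v w : List A} (hv : IsCoxeterTrace (traceOfWord I v))
    (hw : IsCoxeterTrace (traceOfWord I w))
    (h : (rightAngledMatrix I).toCoxeterSystem.wordProd v =
      (rightAngledMatrix I).toCoxeterSystem.wordProd w) :
    traceOfWord I v = traceOfWord I w := by
  induction v generalizing w with
  | nil =>
    cases w with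
    | nil => rfl
    | cons c w =>
      have h1 := position_eq I (c :: w)
      rw [← h, ← position_eq] at h1
      have h2 := increment_reflect_same I c (position I w)
      rw [← position_cons, h1, increment_position_nil] at h2
      linarith [hw.increment_pos I]
  | cons c v ih =>
    have h1 : position I (c :: v) = position I w := by rw [position_eq, h, ← position_eq]
    have h2 := increment_reflect_same I c (position I v)
    rw [← position_cons, h1] at h2
    obtain ⟨w', hw'⟩ := (hw.increment_dichotomy I).2 c (by linarith [hv.increment_pos I])
    rw [hw', traceOfWord_cons, traceOfWord_cons]
    rw [hw'] at hw
    refine congrArg _ (ih hv.of_cons hw.of_cons ?_)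
    rw [← traceToCoxeter_traceOfWord, ← traceToCoxeter_traceOfWord I w, hw',
      traceToCoxeter_traceOfWord, traceToCoxeter_traceOfWord, CoxeterSystem.wordProd_cons,
      CoxeterSystem.wordProd_cons] at h
    exact mul_left_cancel h

theorem existsUnique_isCoxeterTrace (g : RightAngledCoxeterGroup I) :
    ∃! u : TraceMonoid I, IsCoxeterTrace u ∧ traceToCoxeter I u = g := by
  obtain ⟨w, rfl⟩ := (rightAngledMatrix I).toCoxeterSystem.wordProd_surjective g
  obtain ⟨v, hv, hvw⟩ := exists_isCoxeterTrace I w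
  refine ⟨traceOfWord I v, ⟨hv, by rw [traceToCoxeter_traceOfWord, hvw]⟩, ?_⟩
  rintro u ⟨hu, huw⟩
  obtain ⟨u, rfl⟩ := traceOfWord_surjective I u
  rw [traceToCoxeter_traceOfWord] at huw
  exact hu.eq_of_wordProd_eq I hv (huw.trans hvw.symm)

/-- The position depends only on the group element, so it may be evaluated on any word for the
Coxeter-trace, where `IsCoxeterTrace.position_support` applies. -/
theorem mem_reducedAlphabet_iff (w : List A) (a : A) :
    a ∈ reducedAlphabet I w ↔ position I w a ≠ 0 := by
  obtain ⟨hu, huw⟩ := Classical.epsilon_spec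
    (existsUnique_isCoxeterTrace I (traceToCoxeter I (traceOfWord I w))).exists
  change IsCoxeterTrace (coxeterTrace I (traceToCoxeter I (traceOfWord I w))) at hu
  change traceToCoxeter I (coxeterTrace I (traceToCoxeter I (traceOfWord I w))) = _ at huw
  simp only [reducedAlphabet, traceAlphabet, Finset.mem_filter, Finset.mem_univ, true_and]
  have key : ∀ v : List A,
      traceOfWord I v = coxeterTrace I (traceToCoxeter I (traceOfWord I w)) →
        (position I w a ≠ 0 ↔ a ∈ v) := by
    intro v hv
    rw [← hv] at hu huw
    rw [traceToCoxeter_traceOfWord, traceToCoxeter_traceOfWord] at huw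
    rw [← (hu.position_support I a).2, position_eq, position_eq, huw]
  constructor
  · rintro ⟨v, hv, hav⟩
    exact (key v hv).2 hav
  · intro h
    obtain ⟨v, hv⟩ := traceOfWord_surjective I
      (coxeterTrace I (traceToCoxeter I (traceOfWord I w)))
    exact ⟨v, hv, (key v hv).1 h⟩

/-- The summand `1` absorbs the constant term of the affine reflection in the induction. -/
theorem abs_position_add_one_le (w : List A) (a : A) :
    |position I w a| + 1 ≤ (2 * Fintype.card A + 2 : ℤ) ^ w.length := by
  induction w generalizing a with
  | nil => simp [position]
  | cons c w ih =>
    set X : ℤ := (2 * Fintype.card A + 2 : ℤ) ^ w.length with hX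
    have hX1 : 1 ≤ X := by linarith [ih a, abs_nonneg (position I w a)]
    rw [List.length_cons, pow_succ, ← hX, position_cons]
    have hd : (0 : ℤ) ≤ Fintype.card A := Int.natCast_nonneg _
    by_cases hac : a = c
    · subst hac
      rw [reflect_same, increment]
      have hs : |∑ b, depCoeff I a b * position I w b| ≤ ∑ _b : A, 2 * (X - 1) := by
        refine (Finset.abs_sum_le_sum_abs _ _).trans (Finset.sum_le_sum fun b _ => ?_)
        rw [abs_mul, abs_of_nonneg (depCoeff_nonneg I a b)]
        exact mul_le_mul (depCoeff_le_two I a b) (by linarith [ih b]) (abs_nonneg _) (by norm_num)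
      rw [Finset.sum_const, Finset.card_univ, nsmul_eq_mul] at hs
      have h1 := abs_le.1 hs
      have h2 := abs_le.1 (show |position I w a| ≤ X - 1 by linarith [ih a])
      have : |position I w a + (1 - 2 * position I w a + ∑ b, depCoeff I a b * position I w b)|
          ≤ X + Fintype.card A * (2 * (X - 1)) := by
        rw [abs_le]; constructor <;> linarith
      nlinarith
    · rw [reflect_of_ne I hac]
      have := ih a
      nlinarith

end NumberGame

/-! ### Register programs and their implementation by transducers -/

/-- The instructions of a register program. The instruction `linear t c₀ c p n` evaluates the
linear form `c₀ + ∑ c r * v r`; if the value is nonnegative, it is stored in the register `t` (if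
there is one) and the program continues at `p`, otherwise it continues at `n`. -/
inductive Instr (A : Type*) (B : Type*) (Q R : Type) where
  | linear (target : Option R) (const : ℤ) (coeff : R → ℤ) (pos neg : Q)
  | read (next : TapeCell A → Q × HeadMove)
  | emit (b : B) (next : Q)
  | halt

/-- A bound for the carries that occur when the linear forms of a program are evaluated. -/
def Instr.weight {A B : Type*} {Q R : Type} [Fintype R] : Instr A B Q R → ℕ
  | .linear _ c₀ c _ _ => c₀.natAbs + ∑ r, (c r).natAbs + 1
  | _ => 0

/-- A program with finitely many registers that hold natural numbers. -/
structure RegProgram (A B : Type*) (Q R : Type) where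
  start : Q
  instr : Q → Instr A B Q R

namespace RegProgram

variable {A B : Type*} {Q R : Type}

/-- A configuration of a register program. -/
structure Config (Q R : Type) (B : Type*) where
  state : Q
  inputPos : ℕ
  reg : R → ℕ
  output : List B

open Classical in
/-- The register contents after storing `s` in the register `t`, if there is one. -/
noncomputable def store (t : Option R) (s : ℤ) (v : R → ℕ) : R → ℕ :=
  fun r => if t = some r then s.toNat else v r

/-- The value of a linear form. -/
def linearValue [Fintype R] (c₀ : ℤ) (c : R → ℤ) (v : R → ℕ) : ℤ := c₀ + ∑ r, c r * v r

/-- One step of a program on input `w`, where the values of the linear forms have at most `β`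
binary digits. -/
inductive Step [Fintype R] (P : RegProgram A B Q R) (β : ℕ) (w : List A) :
    Config Q R B → Config Q R B → Prop
  | nonneg {q i v o t c₀ c p n} (h : P.instr q = .linear t c₀ c p n)
      (h0 : 0 ≤ linearValue c₀ c v) (h1 : linearValue c₀ c v < 2 ^ β) :
      Step P β w ⟨q, i, v, o⟩ ⟨p, i, store t (linearValue c₀ c v) v, o⟩
  | neg {q i v o c₀ c p n} (h : P.instr q = .linear none c₀ c p n)
      (h0 : linearValue c₀ c v < 0) (h1 : -2 ^ β ≤ linearValue c₀ c v) :
      Step P β w ⟨q, i, v, o⟩ ⟨n, i, v, o⟩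
  | read {q i v o f} (h : P.instr q = .read f) :
      Step P β w ⟨q, i, v, o⟩ ⟨(f (Transducer.cellAt w i)).1,
        Transducer.moveInput w.length (f (Transducer.cellAt w i)).2 i, v, o⟩
  | emit {q i v o b p} (h : P.instr q = .emit b p) :
      Step P β w ⟨q, i, v, o⟩ ⟨p, i, v, o ++ [b]⟩

/-- The states of the transducer: at an instruction, evaluating a linear form with a carry, and
returning to the left end of the work tape. -/
abbrev MachineState (Q : Type) (K : ℕ) : Type := Q ⊕ (Q × Set.Icc (-(K : ℤ)) K) ⊕ Q

/-- A carry, as an element of a finite type. -/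
noncomputable def carryOf (K : ℕ) (z : ℤ) : Set.Icc (-(K : ℤ)) K :=
  Set.projIcc _ _ (by omega) z

theorem coe_carryOf {K : ℕ} {z : ℤ} (h : |z| ≤ K) : (carryOf K z : ℤ) = z := by
  rw [carryOf, Set.projIcc_of_mem _ (abs_le.1 h)]

/-- The contribution of a column of binary digits to the value of a linear form. -/
def columnSum [Fintype R] (c : R → ℤ) (col : R → Bool) : ℤ := ∑ r, c r * (col r).toNat

open Classical in
/-- The column of digits that is written over the column `col` if `s` is the sum of the carry and
the contribution of `col`. -/
noncomputable def newColumn (t : Option R) (s : ℤ) (col : R → Bool) : R → Bool :=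
  fun r => if t = some r then decide (s % 2 = 1) else col r

open Classical in
/-- The action of the transducer when it evaluates a linear form. -/
noncomputable def sweepAction [Fintype R] (K : ℕ) (q : Q) (t : Option R) (c : R → ℤ) (p n : Q)
    (k : ℤ) (sym : Option (R → Bool)) :
    TransducerAction B (MachineState Q K) (Option (R → Bool)) :=
  -- As in two's complement: beyond the last stored column, a carry `0` or `-1` reproduces itself
  -- forever and is the sign of the value.
  if sym = none ∧ (k = 0 ∨ k = -1) then
    ⟨.inr (.inr (if k = 0 then p else n)), none, .stay, .left, none⟩
  else
    let col := sym.getD fun _ => false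
    let s := k + columnSum c col
    -- Division rounds down, so negative sums are carried correctly.
    ⟨.inr (.inl (q, carryOf K (s / 2))), some (newColumn t s col), .stay, .right, none⟩

/-- The transition function of the transducer that implements a program. -/
noncomputable def transition [Fintype R] (P : RegProgram A B Q R) (K : ℕ) :
    MachineState Q K → TapeCell A → Option (R → Bool) →
      Option (TransducerAction B (MachineState Q K) (Option (R → Bool)))
  | .inl q, x, sym =>
    match P.instr q with
    | .linear _ c₀ _ _ _ => some ⟨.inr (.inl (q, carryOf K c₀)), sym, .stay, .right, none⟩
    | .read f => some ⟨.inl (f x).1, sym, (f x).2, .stay, none⟩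
    | .emit b p => some ⟨.inl p, sym, .stay, .stay, some b⟩
    | .halt => none
  | .inr (.inl (q, k)), _, sym =>
    match P.instr q with
    | .linear t _ c p n => some (sweepAction K q t c p n k sym)
    | _ => none
  | .inr (.inr q), _, sym =>
    match sym with
    | some col => some ⟨.inr (.inr q), some col, .stay, .left, none⟩
    | none => some ⟨.inl q, none, .stay, .stay, none⟩

/-- The transducer that implements a program. -/
noncomputable def toTransducer [Finite Q] [Fintype R] (P : RegProgram A B Q R) (K : ℕ) :
    Transducer A B where
  State := MachineState Q K
  WorkSymbol := Option (R → Bool)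
  finiteState := inferInstance
  finiteWorkSymbol := inferInstance
  start := .inl P.start
  blank := none
  transition := P.transition K

/-- The work tape with the registers in binary, one column of digits per cell: cell `0` is blank,
and the digits of weight `2 ^ j` are in cell `j + 1`, for `j < L`. -/
def tapeOf (v : R → ℕ) (L : ℕ) : ℕ → Option (R → Bool)
  | 0 => none
  | j + 1 => if j < L then some fun r => (v r).testBit j else none

theorem newColumn_eq_testBit_store (t : Option R) {s : ℤ} (hs : t = none ∨ 0 ≤ s) (v : R → ℕ) (j : ℕ)
    {z : ℤ} (hz : z % 2 = s / 2 ^ j % 2) :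
    newColumn t z (fun r => (v r).testBit j) = fun r => (store t s v r).testBit j := by
  funext r
  rw [newColumn, store]
  split_ifs with h
  · have h0 : 0 ≤ s := hs.resolve_left fun h' => by simp [h'] at h
    lift s to ℕ using h0
    rw [Int.toNat_natCast, hz, Nat.testBit_eq_decide_div_mod_eq, decide_eq_decide]
    norm_cast
  · rfl

variable [Finite Q] [Fintype R]

/-- A configuration of the transducer between two instructions. -/
noncomputable def machineConfig (P : RegProgram A B Q R) (K : ℕ) (c : Config Q R B) (L : ℕ) :
    (P.toTransducer K).Config where
  state := .inl c.state
  inputPos := c.inputPos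
  work := tapeOf c.reg L
  workPos := 0
  output := c.output

end RegProgram

/-! ### Space bounds from a single run -/

namespace Transducer

variable {A B : Type*}

/-- A step from a configuration in which the work head is at one of the cells `0, …, s - 1`. -/
def BStep (M : Transducer A B) (w : List A) (s : ℕ) (c₁ c₂ : M.Config) : Prop :=
  c₁.workPos < s ∧ M.step w c₁ = some c₂

/-- By determinism every configuration reachable from `c₀` lies on the given halting run, so
bounding that run bounds them all. -/
theorem Reaches.exists_of_bounded {M : Transducer A B} {w : List A} {s : ℕ} {c₀ c d : M.Config}
    (h : Relation.ReflTransGen (M.BStep w s) c₀ c) (hc : M.step w c = none) (hs : c.workPos < s)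
    (hd : Relation.ReflTransGen (fun c₁ c₂ => M.step w c₁ = some c₂) c₀ d) : d.workPos < s := by
  induction h using Relation.ReflTransGen.head_induction_on with
  | refl =>
    cases hd using Relation.ReflTransGen.head_induction_on with
    | refl => exact hs
    | head h _ => rw [hc] at h; simp at h
  | head h1 _ ih =>
    cases hd using Relation.ReflTransGen.head_induction_on with
    | refl => exact h1.1
    | head h h2 =>
      rw [h1.2] at h
      exact ih (by rwa [Option.some.inj h])

end Transducer

namespace RegProgram

variable {A B : Type*} {Q R : Type} [Finite Q] [Fintype R]

theorem BStep_of_transition {P : RegProgram A B Q R} {K : ℕ} {w : List A} {s : ℕ}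
    {q q' : MachineState Q K} {i i' : ℕ} {f f' : ℕ → Option (R → Bool)} {k k' : ℕ}
    {o o' : List B} {x : Option (R → Bool)} {mi mw : HeadMove} {e : Option B}
    (h : P.transition K q (Transducer.cellAt w i) (f k) = some ⟨q', x, mi, mw, e⟩) (hs : k < s)
    (hi : Transducer.moveInput w.length mi i = i') (hf : Function.update f k x = f')
    (hk : Transducer.moveWork mw k = k') (ho : o ++ e.toList = o') :
    (P.toTransducer K).BStep w s ⟨q, i, f, k, o⟩ ⟨q', i', f', k', o'⟩ := by
  subst hi hf hk ho
  refine ⟨hs, ?_⟩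
  change (P.transition K q (Transducer.cellAt w i) (f k)).map _ = _
  rw [h]
  rfl

theorem BStep_return (P : RegProgram A B Q R) (K : ℕ) (w : List A) (s : ℕ) (q : Q) (i : ℕ)
    (v : R → ℕ) (L : ℕ) (o : List B) (j : ℕ) (hj : j ≤ L) (hs : L < s) :
    Relation.ReflTransGen ((P.toTransducer K).BStep w s)
      ⟨.inr (.inr q), i, tapeOf v L, j, o⟩ (P.machineConfig K ⟨q, i, v, o⟩ L) := by
  induction j with
  | zero =>
    exact .single (BStep_of_transition (x := none) (mi := .stay) (mw := .stay) (e := none) rfl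
      (by omega) rfl (Function.update_eq_self 0 _) rfl (by simp))
  | succ j ih =>
    have h : tapeOf v L (j + 1) = some fun r => (v r).testBit j := if_pos (by omega)
    refine .head (BStep_of_transition (mi := .stay) (mw := .left) (e := none)
      (by rw [h]; rfl) (by omega) rfl ?_ rfl (by simp)) (ih (by omega))
    rw [← h, Function.update_eq_self]

/-! ### Evaluating a linear form by binary addition -/

/-- The carry into the digit of weight `2 ^ j` in the evaluation of a linear form. -/
def carryAt (c₀ : ℤ) (c : R → ℤ) (v : R → ℕ) (j : ℕ) : ℤ :=
  linearValue c₀ c v / 2 ^ j - ∑ r, c r * (v r / 2 ^ j : ℕ)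

theorem carryAt_zero (c₀ : ℤ) (c : R → ℤ) (v : R → ℕ) : carryAt c₀ c v 0 = c₀ := by
  simp [carryAt, linearValue]

theorem carryAt_add_columnSum (c₀ : ℤ) (c : R → ℤ) (v : R → ℕ) (j : ℕ) :
    carryAt c₀ c v j + columnSum c (fun r => (v r).testBit j) =
      linearValue c₀ c v / 2 ^ j - 2 * ∑ r, c r * (v r / 2 ^ (j + 1) : ℕ) := by
  have h : ∀ r, ((v r / 2 ^ j : ℕ) : ℤ) =
      2 * (v r / 2 ^ (j + 1) : ℕ) + ((v r).testBit j).toNat := by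
    intro r
    rw [Nat.toNat_testBit, pow_succ, ← Nat.div_div_eq_div_mul]
    omega
  rw [carryAt, columnSum]
  simp only [h, mul_add, Finset.sum_add_distrib, Finset.mul_sum]
  simp only [mul_left_comm]
  ring

/-- The closed form of the carry satisfies the recursion of the sweep: iterated floor division by
`2` is floor division by a power of `2`, and the even term of `carryAt_add_columnSum` passes through
it. -/
theorem carryAt_succ (c₀ : ℤ) (c : R → ℤ) (v : R → ℕ) (j : ℕ) :
    (carryAt c₀ c v j + columnSum c (fun r => (v r).testBit j)) / 2 = carryAt c₀ c v (j + 1) := by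
  have : linearValue c₀ c v / 2 ^ (j + 1) = linearValue c₀ c v / 2 ^ j / 2 := by
    rw [pow_succ, Int.ediv_ediv_of_nonneg (by positivity)]
  rw [carryAt_add_columnSum, carryAt, this]
  omega

theorem carry_emod (c₀ : ℤ) (c : R → ℤ) (v : R → ℕ) (j : ℕ) :
    (carryAt c₀ c v j + columnSum c (fun r => (v r).testBit j)) % 2 =
      linearValue c₀ c v / 2 ^ j % 2 := by
  rw [carryAt_add_columnSum]
  omega

/-- The bound exceeds the largest column sum, so adding a column and halving preserves it. Thus
carries fit into the finite state set. -/
theorem abs_carryAt_le (c₀ : ℤ) (c : R → ℤ) (v : R → ℕ) (j : ℕ) :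
    |carryAt c₀ c v j| ≤ (c₀.natAbs + ∑ r, (c r).natAbs + 1 : ℕ) := by
  induction j with
  | zero => rw [carryAt_zero, Int.abs_eq_natAbs]; omega
  | succ j ih =>
    have h : |columnSum c (fun r => (v r).testBit j)| ≤ (∑ r, (c r).natAbs : ℕ) := by
      rw [columnSum]
      refine (Finset.abs_sum_le_sum_abs _ _).trans ?_
      push_cast
      refine Finset.sum_le_sum fun r _ => ?_
      cases (v r).testBit j <;> simp
    rw [← carryAt_succ]
    rw [abs_le] at *
    omega

theorem carryAt_of_lt (c₀ : ℤ) (c : R → ℤ) (v : R → ℕ) {j : ℕ} (h : ∀ r, v r < 2 ^ j) :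
    carryAt c₀ c v j = linearValue c₀ c v / 2 ^ j := by
  simp [carryAt, Nat.div_eq_of_lt (h _)]

/-- The carry `carryAt c₀ c v j` in the state and the half-rewritten tape `mid j` are the invariant
of the sweep. The head gets no further than cell `L' + 1 ≤ β + 1`, whence the space `β + 2`. -/
theorem BStep_linear (P : RegProgram A B Q R) (K : ℕ) (w : List A) (β : ℕ) {q : Q} (i : ℕ)
    {v : R → ℕ} (o : List B) {t : Option R} {c₀ : ℤ} {c : R → ℤ} {p n : Q}
    (hq : P.instr q = .linear t c₀ c p n) (hK : (P.instr q).weight ≤ K)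
    (hlo : -2 ^ β ≤ linearValue c₀ c v) (hhi : linearValue c₀ c v < 2 ^ β)
    (ht : t = none ∨ 0 ≤ linearValue c₀ c v) {L : ℕ} (hL : L ≤ β) (hv : ∀ r, v r < 2 ^ L) :
    ∃ L' ≤ β, (∀ r, store t (linearValue c₀ c v) v r < 2 ^ L') ∧
      Relation.ReflTransGen ((P.toTransducer K).BStep w (β + 2))
        (P.machineConfig K ⟨q, i, v, o⟩ L)
        (P.machineConfig K ⟨if 0 ≤ linearValue c₀ c v then p else n, i,
          store t (linearValue c₀ c v) v, o⟩ L') := by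
  classical
  set S := linearValue c₀ c v with hS
  rw [hq, Instr.weight] at hK
  have hβ : L ≤ β ∧ (S / 2 ^ β = 0 ∨ S / 2 ^ β = -1) := by
    refine ⟨hL, ?_⟩
    rcases le_or_gt 0 S with h | h
    · exact .inl (Int.ediv_eq_zero_of_lt h hhi)
    · right
      have h1 : -1 ≤ S / 2 ^ β := by rw [Int.le_ediv_iff_mul_le (by positivity)]; linarith
      have h2 : S / 2 ^ β < 0 := Int.ediv_neg_of_neg_of_pos h (by positivity)
      omega
  -- The sweep stops at the first column past the old digits where only the sign of `S` is left; the
  -- range of `S` puts it at `β` or before.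
  have hex : ∃ j, L ≤ j ∧ (S / 2 ^ j = 0 ∨ S / 2 ^ j = -1) := ⟨β, hβ⟩
  obtain ⟨L', hL', ⟨hLL, hfin⟩, hmin⟩ : ∃ L' ≤ β, (L ≤ L' ∧ (S / 2 ^ L' = 0 ∨ S / 2 ^ L' = -1)) ∧
      ∀ j < L', L ≤ j → S / 2 ^ j ≠ 0 ∧ S / 2 ^ j ≠ -1 :=
    ⟨Nat.find hex, Nat.find_le hβ, Nat.find_spec hex, fun j hj hLj => by
      have := Nat.find_min hex hj
      tauto⟩
  have hvL : ∀ j, L ≤ j → ∀ r, v r < 2 ^ j := fun j hj r =>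
    (hv r).trans_le (Nat.pow_le_pow_right (by norm_num) hj)
  have hcarry : ∀ j, (carryOf K (carryAt c₀ c v j) : ℤ) = carryAt c₀ c v j := fun j =>
    coe_carryOf ((abs_carryAt_le c₀ c v j).trans (by exact_mod_cast hK))
  set v' := store t S v with hv'
  have hv'L : ∀ r, v' r < 2 ^ L' := by
    intro r
    rw [hv', store]
    split_ifs with h
    · have h0 : 0 ≤ S := ht.resolve_left fun h' => by simp [h'] at h
      have : S < 2 ^ L' := by
        have h1 : S / 2 ^ L' = 0 := by
          have := Int.ediv_nonneg h0 (show (0 : ℤ) ≤ 2 ^ L' by positivity)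
          omega
        have := Int.lt_ediv_add_one_mul_self S (show (0 : ℤ) < 2 ^ L' by positivity)
        rw [h1] at this
        linarith
      zify
      omega
    · exact hvL L' hLL r
  refine ⟨L', hL', hv'L, ?_⟩
  -- New digits up to cell `j`, old digits beyond.
  let mid : ℕ → ℕ → Option (R → Bool) := fun j k => if k ≤ j then tapeOf v' L' k else tapeOf v L k
  have hmid0 : mid 0 = tapeOf v L := by
    funext k
    cases k with
    | zero => rfl
    | succ k => exact if_neg (by omega)
  have hmidL : mid L' = tapeOf v' L' := by
    funext k
    by_cases hk : k ≤ L'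
    · exact if_pos hk
    · obtain ⟨k, rfl⟩ := Nat.exists_eq_succ_of_ne_zero (show k ≠ 0 by omega)
      simp only [mid, if_neg hk, tapeOf]
      rw [if_neg (by omega), if_neg (by omega)]
  have hmid : ∀ j < L', (mid j (j + 1)).getD (fun _ => false) = fun r => (v r).testBit j := by
    intro j hj
    simp only [mid, if_neg (Nat.not_succ_le_self j), tapeOf]
    split_ifs with h
    · rfl
    · funext r
      exact (Nat.testBit_eq_false_of_lt (hvL j (by omega) r)).symm
  have hloop : ∀ j ≤ L', Relation.ReflTransGen ((P.toTransducer K).BStep w (β + 2))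
      (P.machineConfig K ⟨q, i, v, o⟩ L)
      ⟨.inr (.inl (q, carryOf K (carryAt c₀ c v j))), i, mid j, j + 1, o⟩ := by
    intro j
    induction j with
    | zero =>
      intro _
      rw [hmid0, carryAt_zero]
      exact .single (BStep_of_transition (x := none) (mi := .stay) (mw := .right) (e := none)
        (by simp only [transition, hq]; rfl) (by omega) rfl (Function.update_eq_self 0 _) rfl
        (by simp))
    | succ j ih =>
      intro hj
      refine .tail (ih (by omega)) ?_
      have hns : ¬ (mid j (j + 1) = none ∧ ((carryOf K (carryAt c₀ c v j) : ℤ) = 0 ∨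
          (carryOf K (carryAt c₀ c v j) : ℤ) = -1)) := by
        rintro ⟨h1, h2⟩
        have hLj : L ≤ j := by
          by_contra hlt
          simp only [mid, if_neg (Nat.not_succ_le_self j), tapeOf] at h1
          rw [if_pos (by omega)] at h1
          simp at h1
        rw [hcarry, carryAt_of_lt c₀ c v (hvL j hLj)] at h2
        have := hmin j (by omega) hLj
        tauto
      have hact : P.transition K (.inr (.inl (q, carryOf K (carryAt c₀ c v j))))
          (Transducer.cellAt w i) (mid j (j + 1)) =
          some ⟨.inr (.inl (q, carryOf K (carryAt c₀ c v (j + 1)))),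
            some fun r => (v' r).testBit j, .stay, .right, none⟩ := by
        simp only [transition, hq, sweepAction]
        rw [if_neg hns, hmid j (by omega), hcarry, carryAt_succ,
          newColumn_eq_testBit_store t ht v j (carry_emod c₀ c v j)]
      refine BStep_of_transition hact (by omega) rfl ?_ rfl (by simp)
      funext k
      by_cases hk : k = j + 1
      · subst hk
        simp only [Function.update_self, mid, if_pos le_rfl, tapeOf]
        rw [if_pos (by omega)]
      · rw [Function.update_of_ne hk]
        simp only [mid, show k ≤ j + 1 ↔ k ≤ j by omega]
  have hend : mid L' (L' + 1) = none := by
    rw [hmidL]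
    exact if_neg (lt_irrefl _)
  have hc : carryAt c₀ c v L' = S / 2 ^ L' := carryAt_of_lt c₀ c v (hvL L' hLL)
  have hsign : S / 2 ^ L' = 0 ↔ 0 ≤ S := by
    constructor
    · intro h
      by_contra hneg
      have := Int.ediv_neg_of_neg_of_pos (not_le.1 hneg) (show (0 : ℤ) < 2 ^ L' by positivity)
      omega
    · intro h
      have := Int.ediv_nonneg h (show (0 : ℤ) ≤ 2 ^ L' by positivity)
      omega
  have hact : P.transition K (.inr (.inl (q, carryOf K (carryAt c₀ c v L'))))
      (Transducer.cellAt w i) (mid L' (L' + 1)) =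
      some ⟨.inr (.inr (if 0 ≤ S then p else n)), none, .stay, .left, none⟩ := by
    simp only [transition, hq, sweepAction, hend]
    rw [if_pos (by rw [hcarry, hc]; exact ⟨trivial, hfin⟩), hcarry, hc]
    simp only [hsign]
  refine (hloop L' le_rfl).trans (.head (BStep_of_transition hact (by omega) rfl
    (f' := tapeOf v' L') ?_ rfl (by simp))
      (BStep_return P K w (β + 2) _ i v' L' o L' le_rfl (by omega)))
  rw [← hmidL, ← hend, Function.update_eq_self]

theorem BStep_of_step (P : RegProgram A B Q R) {K : ℕ} (hK : ∀ q, (P.instr q).weight ≤ K)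
    {w : List A} {β : ℕ} {c d : Config Q R B} (h : P.Step β w c d) {L : ℕ} (hL : L ≤ β)
    (hv : ∀ r, c.reg r < 2 ^ L) :
    ∃ L' ≤ β, (∀ r, d.reg r < 2 ^ L') ∧ Relation.ReflTransGen ((P.toTransducer K).BStep w (β + 2))
      (P.machineConfig K c L) (P.machineConfig K d L') := by
  cases h with
  | @nonneg q i v o t c₀ c p n h h0 h1 =>
    have := P.BStep_linear K w β i o h (hK q) (by linarith [show (0 : ℤ) < 2 ^ β by positivity])
      h1 (.inr h0) hL hv
    rwa [if_pos h0] at this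
  | @neg q i v o c₀ c p n h h0 h1 =>
    have := P.BStep_linear K w β i o h (hK q) h1 (by linarith [show (0 : ℤ) < 2 ^ β by positivity])
      (.inl rfl) hL hv
    rwa [if_neg (by omega)] at this
  | read h =>
    exact ⟨L, hL, hv, .single (BStep_of_transition (x := none) (mw := .stay) (e := none)
      (by simp only [transition, h]; rfl) (by omega) rfl (Function.update_eq_self 0 _) rfl
        (by simp))⟩
  | emit h =>
    exact ⟨L, hL, hv, .single (BStep_of_transition (x := none) (mi := .stay) (mw := .stay)
      (by simp only [transition, h]; rfl) (by omega) rfl (Function.update_eq_self 0 _) rfl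
        (by simp))⟩

/-- The initial configuration of a program. -/
def initial (P : RegProgram A B Q R) : Config Q R B := ⟨P.start, 0, 0, []⟩

theorem logspaceComputable (P : RegProgram A B Q R) (f : List A → List B) (k : ℕ)
    (h : ∀ w, ∃ c : Config Q R B,
      Relation.ReflTransGen (P.Step (k * (Nat.log 2 w.length + 1)) w) P.initial c ∧
        P.instr c.state = .halt ∧ c.output = f w) :
    LogspaceComputable f := by
  classical
  obtain ⟨K, hK⟩ : ∃ K, ∀ q, (P.instr q).weight ≤ K := by
    obtain ⟨K, hK⟩ := (Set.finite_range fun q => (P.instr q).weight).bddAbove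
    exact ⟨K, fun q => hK ⟨q, rfl⟩⟩
  have key : ∀ w, ∃ c : (P.toTransducer K).Config,
      Relation.ReflTransGen ((P.toTransducer K).BStep w (k * (Nat.log 2 w.length + 1) + 2))
        (P.toTransducer K).init c ∧ (P.toTransducer K).step w c = none ∧ c.output = f w ∧
        c.workPos = 0 := by
    intro w
    obtain ⟨c, hc, hhalt, hout⟩ := h w
    have hrun : ∃ L ≤ k * (Nat.log 2 w.length + 1), (∀ r, c.reg r < 2 ^ L) ∧
        Relation.ReflTransGen ((P.toTransducer K).BStep w (k * (Nat.log 2 w.length + 1) + 2))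
          (P.machineConfig K P.initial 0) (P.machineConfig K c L) := by
      clear hhalt hout
      induction hc with
      | refl => exact ⟨0, by omega, fun r => by simp [initial], .refl⟩
      | tail _ hstep ih =>
        obtain ⟨L, hL, hv, hr⟩ := ih
        obtain ⟨L', hL', hv', hr'⟩ := P.BStep_of_step hK hstep hL hv
        exact ⟨L', hL', hv', hr.trans hr'⟩
    obtain ⟨L, -, -, hr⟩ := hrun
    refine ⟨P.machineConfig K c L, ?_, ?_, hout, rfl⟩
    · convert hr using 1
      refine Transducer.Config.ext rfl rfl ?_ rfl rfl
      funext j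
      cases j <;> rfl
    · change (P.transition K (.inl c.state) _ _).map _ = none
      simp only [transition, hhalt]
      rfl
  refine ⟨P.toTransducer K, k + 2, fun w => ?_, fun w d hd => ?_⟩
  · obtain ⟨c, hr, hhalt, hout, -⟩ := key w
    exact ⟨c, Relation.ReflTransGen.mono (fun _ _ h => h.2) _ _ hr, hhalt, hout⟩
  · obtain ⟨c, hr, hhalt, -, hpos⟩ := key w
    refine (Transducer.Reaches.exists_of_bounded hr hhalt (by omega) hd).trans_le ?_
    simp only [add_mul]
    omega

end RegProgram

/-! ### Small moduli separate small integers from zero -/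

/-- Every prime power in the factorization of the binomial coefficient `(2h choose h)` is at most
`2h`, hence is one of the assumed divisors. -/
theorem centralBinom_dvd_of_forall_dvd {h : ℕ} {x : ℕ} (hx : ∀ m, 0 < m → m ≤ 2 * h → m ∣ x) :
    h.centralBinom ∣ x := by
  rcases Nat.eq_zero_or_pos h with rfl | hpos
  · simp
  rcases eq_or_ne x 0 with rfl | hx0
  · simp
  rw [← Nat.factorization_le_iff_dvd h.centralBinom_ne_zero hx0]
  intro p
  by_cases hp : p.Prime
  · rw [← hp.pow_dvd_iff_le_factorization hx0]
    exact hx _ (pow_pos hp.pos _) (Nat.pow_factorization_choose_le (by omega))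
  · simp [Nat.factorization_eq_zero_of_not_prime _ hp]

/-- Otherwise the central binomial coefficient is at most `|x| < 2^h`; with `2h ≤ 2^h` this
contradicts `4^h ≤ 2h * centralBinom h`. -/
theorem exists_not_dvd_of_lt_two_pow {h : ℕ} (hpos : 0 < h) {x : ℤ} (hx0 : x ≠ 0)
    (hx : |x| < 2 ^ h) : ∃ m : ℕ, 0 < m ∧ m ≤ 2 * h ∧ ¬ (m : ℤ) ∣ x := by
  by_contra! hall
  have h1 : h.centralBinom ≤ x.natAbs :=
    Nat.le_of_dvd (Int.natAbs_pos.2 hx0)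
      (centralBinom_dvd_of_forall_dvd fun m h0 hm => Int.natCast_dvd.1 (hall m h0 hm))
  have h2 := Nat.four_pow_le_two_mul_self_mul_centralBinom h hpos
  have h3 : x.natAbs < 2 ^ h := by zify; exact hx
  have h4 : 2 * h ≤ 2 ^ h := by
    obtain ⟨k, rfl⟩ := Nat.exists_eq_succ_of_ne_zero hpos.ne'
    rw [Nat.succ_eq_add_one, pow_succ]
    have := Nat.lt_two_pow_self (n := k)
    omega
  have h5 : (4 : ℕ) ^ h = 2 ^ h * 2 ^ h := by rw [← mul_pow]; norm_num
  have h6 : 2 * h * h.centralBinom < 2 ^ h * 2 ^ h :=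
    Nat.mul_lt_mul_of_le_of_lt h4 (h1.trans_lt h3) (by positivity)
  omega

/-! ### The program that computes the alphabet -/

/-- The states of the program; the set `F` consists of the letters found so far. -/
inductive AlphabetState (d K : ℕ) : Type
  | count
  | bump
  | outer (F : Finset (Fin d))
  | next (F : Finset (Fin d))
  | scan (F : Finset (Fin d))
  | update (F : Finset (Fin d)) (a : Fin d)
  | reduce (F : Finset (Fin d)) (a : Fin d)
  | subtract (F : Finset (Fin d)) (a : Fin d)
  | rewind (F : Finset (Fin d))
  | check (F : Finset (Fin d)) (i : Fin (d + 1))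
  | clear (F : Finset (Fin d)) (i : Fin (d + 1))
  | out (F : Finset (Fin d)) (j : Fin (K + 1))
  deriving Fintype

/-- The registers: one per letter, the modulus (`false`), and the bound for the moduli (`true`). -/
abbrev AlphabetRegister (d : ℕ) : Type := Fin d ⊕ Bool

/-- A function on the registers with given values. -/
def onRegisters {d : ℕ} {α : Type*} (x : Fin d → α) (m N : α) : AlphabetRegister d → α :=
  Sum.elim x fun b => if b then N else m

/-- The successor, capped at the last element. -/
def Fin.capSucc {n : ℕ} (i : Fin (n + 1)) : Fin (n + 1) := ⟨min (i + 1) n, by omega⟩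

section Program

theorem RegProgram.Step.nonneg_of_eq {A B : Type*} {Q R : Type} [Fintype R] {P : RegProgram A B Q R} {β : ℕ}
    {w : List A} {q p n : Q} {i : ℕ} {v v' : R → ℕ} {o : List B} {t : Option R} {c₀ : ℤ}
    {c : R → ℤ} (s : ℕ) (h : P.instr q = .linear t c₀ c p n) (hs : linearValue c₀ c v = s)
    (hβ : s < 2 ^ β) (hv : store t s v = v') : P.Step β w ⟨q, i, v, o⟩ ⟨p, i, v', o⟩ := by
  subst hv
  rw [← hs]
  exact .nonneg h (by omega) (by rw [hs]; exact_mod_cast hβ)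

variable {A B : Type*} (I : SimpleGraph A) {d : ℕ} (e : A ≃ Fin d) (K C : ℕ)
  (enc : Finset (Fin d) → List B)

open AlphabetState in
/-- The program first multiplies the input length by `C`; for every modulus `m` up to this bound it
computes the position vector of the input modulo `m`, and collects the nonzero coordinates. -/
noncomputable def alphabetProgram :
    RegProgram A B (AlphabetState d K) (AlphabetRegister d) where
  start := count
  instr
    | count => .read fun
      | .leftEnd => (count, .right)
      | .letter _ => (bump, .right)
      | .rightEnd => (outer ∅, .stay)
    | bump => .linear (some (.inr true)) C (onRegisters 0 0 1) count count
    -- Nonnegative exactly when the modulus is still below the bound.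
    | outer F => .linear none (-1) (onRegisters 0 (-1) 1) (next F) (out F 0)
    | next F => .linear (some (.inr false)) 1 (onRegisters 0 1 0) (scan F) (scan F)
    -- The input is read from right to left because `position` folds from the right.
    | scan F => .read fun
      | .leftEnd => (rewind F, .stay)
      | .letter a => (update F (e a), .left)
      | .rightEnd => (scan F, .left)
    -- The new coordinate `1 - x a + ∑ depCoeff * x b`, plus the modulus: this keeps the value
    -- nonnegative without changing its residue.
    | update F a => .linear (some (.inl a)) 1
        (onRegisters (fun b => depCoeff I (e.symm a) (e.symm b) - (Pi.single a 1 : Fin d → ℤ) b) 1 0)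
        (reduce F a) (reduce F a)
    | reduce F a => .linear none 0 (onRegisters (Pi.single a 1) (-1) 0) (subtract F a) (scan F)
    | subtract F a => .linear (some (.inl a)) 0 (onRegisters (Pi.single a 1) (-1) 0)
        (reduce F a) (reduce F a)
    | rewind F => .read fun
      | .rightEnd => (check F 0, .stay)
      | _ => (rewind F, .right)
    -- Nonzero residues are recorded in `F` and reset to `0`, so that the next modulus starts at the
    -- origin again.
    | check F i =>
      if h : (i : ℕ) < d then
        .linear none (-1) (onRegisters (Pi.single ⟨i, h⟩ 1) 0 0) (clear (insert ⟨i, h⟩ F) i)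
          (check F i.capSucc)
      else .read fun _ => (outer F, .stay)
    | clear F i =>
      if h : (i : ℕ) < d then
        .linear (some (.inl ⟨i, h⟩)) 0 0 (check F i.capSucc) (check F i.capSucc)
      else .halt
    | out F j =>
      if h : (j : ℕ) < (enc F).length then .emit (enc F)[j] (out F j.capSucc) else .halt

theorem linearValue_onRegisters (c₀ : ℤ) (cx : Fin d → ℤ) (cm cN : ℤ) (x : Fin d → ℕ) (m N : ℕ) :
    RegProgram.linearValue c₀ (onRegisters cx cm cN) (onRegisters x m N) =
      c₀ + (∑ b, cx b * x b + cm * m + cN * N) := by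
  simp [RegProgram.linearValue, onRegisters]
  ring

theorem store_letter (a : Fin d) (s : ℤ) (x : Fin d → ℕ) (m N : ℕ) :
    RegProgram.store (some (.inl a)) s (onRegisters x m N) =
      onRegisters (Function.update x a s.toNat) m N := by
  funext r
  rcases r with b | b
  · by_cases h : b = a
    · subst h; simp [RegProgram.store, onRegisters]
    · simp [RegProgram.store, onRegisters, h, Ne.symm h]
  · simp [RegProgram.store, onRegisters]

theorem store_modulus (s : ℤ) (x : Fin d → ℕ) (m N : ℕ) :
    RegProgram.store (some (.inr false)) s (onRegisters x m N) = onRegisters x s.toNat N := by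
  funext r
  rcases r with b | b
  · simp [RegProgram.store, onRegisters]
  · cases b <;> simp [RegProgram.store, onRegisters]

theorem store_bound (s : ℤ) (x : Fin d → ℕ) (m N : ℕ) :
    RegProgram.store (some (.inr true)) s (onRegisters x m N) = onRegisters x m s.toNat := by
  funext r
  rcases r with b | b
  · simp [RegProgram.store, onRegisters]
  · cases b <;> simp [RegProgram.store, onRegisters]

theorem store_none {R : Type} (s : ℤ) (v : R → ℕ) : RegProgram.store none s v = v := by
  funext r; simp [RegProgram.store]

/-! ### Correctness of the phases of the program -/

variable {I e K C enc} {β : ℕ} {w : List A}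

/-- The reachability relation of the program. -/
local notation "Run" => Relation.ReflTransGen
  (RegProgram.Step (alphabetProgram I e K C enc) β w)

theorem run_count {o : List B} (hβ : C * w.length < 2 ^ β) (j : ℕ) (hj : j ≤ w.length) :
    Run ⟨.count, j + 1, onRegisters 0 0 (C * j), o⟩
      ⟨.outer ∅, w.length + 1, onRegisters 0 0 (C * w.length), o⟩ := by
  induction hn : w.length - j generalizing j with
  | zero =>
    obtain rfl : j = w.length := by omega
    have := RegProgram.Step.read (P := alphabetProgram I e K C enc) (β := β) (w := w)
      (q := .count) (i := w.length + 1) (v := onRegisters 0 0 (C * w.length)) (o := o) rfl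
    simp only [Transducer.cellAt, List.getElem?_length, Transducer.moveInput] at this
    exact .single this
  | succ n ih =>
    have := RegProgram.Step.read (P := alphabetProgram I e K C enc) (β := β) (w := w)
      (q := .count) (i := j + 1) (v := onRegisters 0 0 (C * j)) (o := o) rfl
    simp only [Transducer.cellAt, List.getElem?_eq_getElem (show j < w.length by omega),
      Transducer.moveInput, show min (j + 1 + 1) (w.length + 1) = j + 1 + 1 by omega] at this
    refine .head this (.head ?_ (ih (j + 1) (by omega) (by omega)))
    refine .nonneg_of_eq (C * (j + 1)) rfl ?_ ?_ ?_
    · rw [linearValue_onRegisters]; simp; ring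
    · exact (Nat.mul_le_mul_left C (by omega)).trans_lt hβ
    · rw [store_bound, Int.toNat_natCast]

/-- Reduction modulo `m` by repeated subtraction; time is not restricted. -/
theorem run_reduce {F : Finset (Fin d)} {a : Fin d} {i m N : ℕ} {x : Fin d → ℕ} {o : List B}
    (hm : 0 < m) (hmβ : m < 2 ^ β) (y : ℕ) (hy : y < 2 ^ β) :
    Run ⟨.reduce F a, i, onRegisters (Function.update x a y) m N, o⟩
      ⟨.scan F, i, onRegisters (Function.update x a (y % m)) m N, o⟩ := by
  have hval : ∀ y : ℕ, RegProgram.linearValue 0 (onRegisters (Pi.single a 1) (-1) 0)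
      (onRegisters (Function.update x a y) m N) = y - m := by
    intro y
    rw [linearValue_onRegisters]
    simp [Pi.single_apply]
    ring
  induction y using Nat.strong_induction_on with
  | _ y ih =>
    by_cases h : y < m
    · rw [Nat.mod_eq_of_lt h]
      refine .single (.neg (c₀ := 0) (c := onRegisters (Pi.single a 1) (-1) 0) rfl ?_ ?_)
      · rw [hval]; omega
      · rw [hval]
        have : (m : ℤ) < 2 ^ β := by exact_mod_cast hmβ
        omega
    · rw [Nat.mod_eq_sub_mod (not_lt.1 h)]
      refine .head (.nonneg_of_eq (y - m) rfl (by rw [hval]; omega) (by omega) (store_none _ _))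
        (.head (.nonneg_of_eq (y - m) rfl (by rw [hval]; omega) (by omega) ?_)
          (ih (y - m) (by omega) (by omega)))
      rw [store_letter, Int.toNat_natCast, Function.update_idem]

theorem run_rewind {F : Finset (Fin d)} {v : AlphabetRegister d → ℕ} {o : List B} :
    Run ⟨.rewind F, 0, v, o⟩ ⟨.check F 0, w.length + 1, v, o⟩ := by
  have h : ∀ j ≤ w.length + 1, Run ⟨.rewind F, 0, v, o⟩ ⟨.rewind F, j, v, o⟩ := by
    intro j
    induction j with
    | zero => exact fun _ => .refl
    | succ j ih =>
      intro hj
      refine .tail (ih (by omega)) ?_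
      have := RegProgram.Step.read (P := alphabetProgram I e K C enc) (β := β) (w := w)
        (q := .rewind F) (i := j) (v := v) (o := o) rfl
      cases j with
      | zero =>
        simpa only [Transducer.cellAt, Transducer.moveInput,
          show min (0 + 1) (w.length + 1) = 0 + 1 by omega] using this
      | succ j =>
        simpa only [Transducer.cellAt, List.getElem?_eq_getElem (show j < w.length by omega),
          Transducer.moveInput, show min (j + 1 + 1) (w.length + 1) = j + 1 + 1 by omega] using this
  refine .tail (h _ le_rfl) ?_
  have := RegProgram.Step.read (P := alphabetProgram I e K C enc) (β := β) (w := w)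
    (q := .rewind F) (i := w.length + 1) (v := v) (o := o) rfl
  simpa only [Transducer.cellAt, List.getElem?_length, Transducer.moveInput] using this

/-- Moving a nonzero coordinate into `F` and clearing it leaves the union on the right unchanged. -/
theorem run_check {F : Finset (Fin d)} {i m N : ℕ} {o : List B} (x : Fin d → ℕ)
    (hx : ∀ b, x b < 2 ^ β) (j : Fin (d + 1)) (hj : ∀ b : Fin d, (b : ℕ) < j → x b = 0) :
    Run ⟨.check F j, i, onRegisters x m N, o⟩
      ⟨.outer (F ∪ Finset.univ.filter fun b => x b ≠ 0), i, onRegisters 0 m N, o⟩ := by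
  induction hn : d - j generalizing j x F with
  | zero =>
    have hjd : ¬ (j : ℕ) < d := by omega
    have hx0 : x = 0 := funext fun b => hj b (by omega)
    subst hx0
    simp only [Pi.zero_apply, ne_eq, not_true, Finset.filter_false, Finset.union_empty]
    exact .single (RegProgram.Step.read (P := alphabetProgram I e K C enc)
      (q := .check F j) (f := fun _ => (AlphabetState.outer F, HeadMove.stay)) (dif_neg hjd))
  | succ n ih =>
    have hjd : (j : ℕ) < d := by omega
    have hcap : (j.capSucc : ℕ) = j + 1 := by simp only [Fin.capSucc]; omega
    have hval : RegProgram.linearValue (-1) (onRegisters (Pi.single ⟨j, hjd⟩ 1) 0 0)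
        (onRegisters x m N) = x ⟨j, hjd⟩ - 1 := by
      rw [linearValue_onRegisters]
      simp [Pi.single_apply]
      ring
    have hxj := hx ⟨j, hjd⟩
    by_cases h0 : x ⟨j, hjd⟩ = 0
    · refine .head (.neg (dif_pos hjd) (by rw [hval]; omega) ?_) (ih x hx _ ?_ (by omega))
      · rw [hval, h0]
        have : (1 : ℤ) ≤ 2 ^ β := one_le_pow₀ (by norm_num)
        simpa using this
      · intro b hb
        rcases Nat.lt_or_ge b j with h | h
        · exact hj b h
        · rw [show b = ⟨j, hjd⟩ from Fin.ext (by simp only; omega), h0]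
    · have hF : F ∪ Finset.univ.filter (fun b => x b ≠ 0) = insert ⟨j, hjd⟩ F ∪
          Finset.univ.filter fun b => Function.update x ⟨j, hjd⟩ 0 b ≠ 0 := by
        ext b
        by_cases hb : b = ⟨j, hjd⟩
        · subst hb; simp [h0]
        · simp [hb]
      rw [hF]
      refine .head (.nonneg_of_eq (x ⟨j, hjd⟩ - 1) (dif_pos hjd) (by rw [hval]; omega) (by omega)
        (store_none _ _)) (.head (.nonneg_of_eq 0 (dif_pos hjd) (by simp [RegProgram.linearValue])
          (by positivity) (store_letter _ _ _ _ _)) (ih _ ?_ _ ?_ (by omega)))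
      · intro b
        by_cases hb : b = ⟨j, hjd⟩
        · subst hb; simp
        · simpa [hb] using hx b
      · intro b hb
        by_cases hbj : b = ⟨j, hjd⟩
        · subst hbj; simp
        · have : (b : ℕ) ≠ j := fun h => hbj (Fin.ext h)
          simpa [hbj] using hj b (by omega)

/-- There are finitely many sets `F`, so the place in the output word is kept in the state. -/
theorem run_out (hK : ∀ F, (enc F).length ≤ K) {F : Finset (Fin d)} {i : ℕ}
    {v : AlphabetRegister d → ℕ} : ∃ j : Fin (K + 1),
      (alphabetProgram I e K C enc).instr (.out F j) = .halt ∧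
      Run ⟨.out F 0, i, v, []⟩ ⟨.out F j, i, v, enc F⟩ := by
  have h : ∀ j : ℕ, (hj : j ≤ (enc F).length) →
      Run ⟨.out F 0, i, v, []⟩ ⟨.out F ⟨j, by have := hK F; omega⟩, i, v, (enc F).take j⟩ := by
    intro j
    induction j with
    | zero => exact fun _ => .refl
    | succ j ih =>
      intro hj
      refine .tail (ih (by omega)) ?_
      have hKF := hK F
      have hstep := RegProgram.Step.emit (P := alphabetProgram I e K C enc) (β := β) (w := w)
        (q := .out F ⟨j, by omega⟩) (i := i) (v := v) (o := (enc F).take j)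
        (dif_pos (show j < (enc F).length by omega))
      have hcap : Fin.capSucc (⟨j, by omega⟩ : Fin (K + 1)) = ⟨j + 1, by omega⟩ :=
        Fin.ext (by simp only [Fin.capSucc]; omega)
      rw [hcap] at hstep
      rw [List.take_add_one, List.getElem?_eq_getElem (show j < (enc F).length by omega)]
      exact hstep
  have hKF := hK F
  refine ⟨⟨(enc F).length, by omega⟩, dif_neg (lt_irrefl _), ?_⟩
  simpa only [List.take_length] using h (enc F).length le_rfl

/-! ### Positions modulo small numbers -/

variable [Fintype A]

variable (I e) in
/-- The position vector of a word modulo `m`. -/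
noncomputable def residue (m : ℕ) (u : List A) (b : Fin d) : ℕ :=
  (position I u (e.symm b) % m).toNat

theorem coe_residue {m : ℕ} (hm : 0 < m) (u : List A) (b : Fin d) :
    (residue I e m u b : ℤ) = position I u (e.symm b) % m :=
  Int.toNat_of_nonneg (Int.emod_nonneg _ (by omega))

theorem residue_lt {m : ℕ} (hm : 0 < m) (u : List A) (b : Fin d) : residue I e m u b < m := by
  have h1 := coe_residue (I := I) (e := e) hm u b
  have := Int.emod_lt_of_pos (position I u (e.symm b)) (show (0 : ℤ) < m by omega)
  omega

theorem run_update {F : Finset (Fin d)} {a : A} {i m N : ℕ} {u : List A} {o : List B}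
    (hm : 0 < m) (hβ : (2 * d + 2) * (m + 1) < 2 ^ β) :
    Run ⟨.update F (e a), i, onRegisters (residue I e m u) m N, o⟩
      ⟨.scan F, i, onRegisters (residue I e m (a :: u)) m N, o⟩ := by
  set x := residue I e m u with hx
  have hlt : ∀ b, x b < m := residue_lt hm u
  have hsum : ∑ b, (depCoeff I (e.symm (e a)) (e.symm b) -
      (Pi.single (e a) 1 : Fin d → ℤ) b) * (x b : ℤ) =
      ∑ b, depCoeff I a (e.symm b) * x b - x (e a) := by
    simp [sub_mul, Finset.sum_sub_distrib, Pi.single_apply]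
  have hnn : 0 ≤ ∑ b, depCoeff I a (e.symm b) * (x b : ℤ) :=
    Finset.sum_nonneg fun b _ => mul_nonneg (depCoeff_nonneg I _ _) (by omega)
  have hle : ∑ b, depCoeff I a (e.symm b) * (x b : ℤ) ≤ d * (2 * m) := by
    refine (Finset.sum_le_sum (g := fun _ => 2 * (m : ℤ)) fun b _ => ?_).trans_eq (by simp)
    exact mul_le_mul (depCoeff_le_two I _ _) (by have := hlt b; omega) (by omega) (by norm_num)
  set S := ∑ b, depCoeff I a (e.symm b) * (x b : ℤ) with hS
  have ha := hlt (e a)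
  -- The unreduced value: it is nonnegative since `x (e a) < m`, and at most `1 + 2dm + m`.
  obtain ⟨y, hy⟩ : ∃ y : ℕ, (y : ℤ) = 1 + (S - x (e a) + m) :=
    ⟨(1 + (S - x (e a) + m)).toNat, Int.toNat_of_nonneg (by omega)⟩
  have hyβ : y < 2 ^ β := by
    refine lt_of_le_of_lt ?_ hβ
    zify
    nlinarith
  have hres : residue I e m (a :: u) = Function.update x (e a) (y % m) := by
    funext b
    by_cases hb : b = e a
    · subst hb
      rw [Function.update_self]
      zify
      rw [coe_residue hm, Equiv.symm_apply_apply, position_cons, reflect_same, increment, hy]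
      have hcongr : ∀ b, (x b : ℤ) ≡ position I u (e.symm b) [ZMOD m] := fun b => by
        rw [hx, coe_residue hm]; exact Int.mod_modEq _ _
      have h1 : S ≡ ∑ b, depCoeff I a b * position I u b [ZMOD m] := by
        rw [← Equiv.sum_comp e.symm]
        exact Int.ModEq.sum fun b _ => (hcongr b).mul_left _
      have h2 := hcongr (e a)
      rw [Equiv.symm_apply_apply] at h2
      have h3 := ((h1.sub h2).add_left 1).symm
      have h4 : 1 + (S - x (e a)) ≡ 1 + (S - x (e a) + m) [ZMOD m] := by
        rw [← add_assoc]; exact (Int.add_modEq_right).symm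
      have h5 := h3.trans h4
      rw [Int.ModEq] at h5
      rw [← h5]
      congr 1
      ring
    · rw [Function.update_of_ne hb, hx, residue, residue, position_cons,
        reflect_of_ne I fun h => hb (by rw [← h, Equiv.apply_symm_apply])]
  rw [hres]
  refine .head (.nonneg_of_eq y rfl ?_ hyβ (store_letter _ _ _ _ _)) ?_
  · rw [linearValue_onRegisters, hsum, hy]; ring
  · rw [Int.toNat_natCast]
    exact run_reduce hm (by nlinarith) y hyβ

/-- With the head at `j`, the suffix `w.drop j` is already processed and the scanned letter, if any,
is the one just before it. -/
theorem run_scan {F : Finset (Fin d)} {m N : ℕ} {o : List B}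
    (hm : 0 < m) (hβ : (2 * d + 2) * (m + 1) < 2 ^ β) (j : ℕ) (hj : j ≤ w.length) :
    Run ⟨.scan F, j, onRegisters (residue I e m (w.drop j)) m N, o⟩
      ⟨.rewind F, 0, onRegisters (residue I e m w) m N, o⟩ := by
  induction j with
  | zero =>
    exact .single (RegProgram.Step.read (P := alphabetProgram I e K C enc) (β := β) (w := w)
      (q := .scan F) (i := 0) (v := onRegisters (residue I e m w) m N) (o := o) rfl)
  | succ j ih =>
    have := RegProgram.Step.read (P := alphabetProgram I e K C enc) (β := β) (w := w)
      (q := .scan F) (i := j + 1) (v := onRegisters (residue I e m (w.drop (j + 1))) m N)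
      (o := o) rfl
    simp only [Transducer.cellAt, List.getElem?_eq_getElem (show j < w.length by omega),
      Transducer.moveInput, Nat.add_sub_cancel] at this
    refine .head this ((run_update hm hβ).trans ?_)
    rw [← List.drop_eq_getElem_cons]
    exact ih (by omega)

open Classical in
variable (I e) in
/-- The letters whose coordinates are nonzero modulo some positive number up to `m`. -/
noncomputable def lettersUpTo (w : List A) (m : ℕ) : Finset (Fin d) :=
  Finset.univ.filter fun b => ∃ k : ℕ, 0 < k ∧ k ≤ m ∧ ¬ (k : ℤ) ∣ position I w (e.symm b)

theorem run_modulus {m N : ℕ} {o : List B} (hmN : m < N) (hβ : (2 * d + 2) * (N + 1) < 2 ^ β) :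
    Run ⟨.outer (lettersUpTo I e w m), w.length + 1, onRegisters 0 m N, o⟩
      ⟨.outer (lettersUpTo I e w (m + 1)), w.length + 1, onRegisters 0 (m + 1) N, o⟩ := by
  have hN : N + 1 < 2 ^ β := (Nat.le_mul_of_pos_left _ (by omega)).trans_lt hβ
  have hβ' : (2 * d + 2) * (m + 1 + 1) < 2 ^ β :=
    (Nat.mul_le_mul_left _ (by omega)).trans_lt hβ
  have h0 : residue I e (m + 1) (w.drop w.length) = 0 := by
    funext b; simp [residue, position]
  have hF : lettersUpTo I e w (m + 1) = lettersUpTo I e w m ∪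
      Finset.univ.filter fun b => residue I e (m + 1) w b ≠ 0 := by
    ext b
    have hdvd : residue I e (m + 1) w b ≠ 0 ↔ ¬ ((m + 1 : ℕ) : ℤ) ∣ position I w (e.symm b) := by
      rw [Int.dvd_iff_emod_eq_zero, ← coe_residue m.succ_pos, Nat.cast_eq_zero]
    simp only [lettersUpTo, Finset.mem_filter, Finset.mem_univ, true_and, Finset.mem_union, hdvd]
    constructor
    · rintro ⟨k, hk0, hkm, hk⟩
      rcases Nat.lt_or_ge m k with h | h
      · obtain rfl : k = m + 1 := by omega
        exact .inr hk
      · exact .inl ⟨k, hk0, h, hk⟩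
    · rintro (⟨k, hk0, hkm, hk⟩ | h)
      · exact ⟨k, hk0, by omega, hk⟩
      · exact ⟨m + 1, by omega, le_rfl, h⟩
  rw [hF]
  have hread := RegProgram.Step.read (P := alphabetProgram I e K C enc) (β := β) (w := w)
    (q := .scan (lettersUpTo I e w m)) (i := w.length + 1) (v := onRegisters 0 (m + 1) N)
    (o := o) rfl
  simp only [Transducer.cellAt, List.getElem?_length, Transducer.moveInput,
    Nat.add_sub_cancel] at hread
  have hscan := run_scan (I := I) (e := e) (K := K) (C := C) (enc := enc) (w := w)
    (F := lettersUpTo I e w m) (N := N) (o := o) m.succ_pos hβ' w.length le_rfl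
  rw [h0] at hscan
  refine .head (.nonneg_of_eq (N - m - 1) rfl ?_ (by omega) (store_none _ _))
    (.head (.nonneg_of_eq (m + 1) rfl ?_ (by omega) (store_modulus _ _ _ _))
      (.head hread (hscan.trans (run_rewind.trans (run_check _ (fun b => ?_) 0 ?_)))))
  · rw [linearValue_onRegisters]; simp; omega
  · rw [linearValue_onRegisters]; simp; ring
  · have := residue_lt (I := I) (e := e) m.succ_pos w b
    omega
  · intro b hb
    simp at hb

theorem run_alphabetProgram (hK : ∀ F, (enc F).length ≤ K)
    (hβ : (2 * d + 2) * (C * w.length + 1) < 2 ^ β) :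
    ∃ c : RegProgram.Config (AlphabetState d K) (AlphabetRegister d) B,
      Run (alphabetProgram I e K C enc).initial c ∧
        (alphabetProgram I e K C enc).instr c.state = .halt ∧
        c.output = enc (lettersUpTo I e w (C * w.length)) := by
  have hN : C * w.length + 1 < 2 ^ β := (Nat.le_mul_of_pos_left _ (by omega)).trans_lt hβ
  obtain ⟨j, hhalt, hout⟩ := run_out (I := I) (e := e) (C := C) (β := β) (w := w) hK
    (F := lettersUpTo I e w (C * w.length)) (i := w.length + 1)
    (v := onRegisters 0 (C * w.length) (C * w.length))
  refine ⟨⟨.out _ j, w.length + 1, onRegisters 0 (C * w.length) (C * w.length),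
    enc (lettersUpTo I e w (C * w.length))⟩, ?_, hhalt, rfl⟩
  have hloop : ∀ m ≤ C * w.length,
      Run ⟨.outer ∅, w.length + 1, onRegisters 0 0 (C * w.length), []⟩
        ⟨.outer (lettersUpTo I e w m), w.length + 1, onRegisters 0 m (C * w.length), []⟩ := by
    intro m
    induction m with
    | zero =>
      intro _
      have : lettersUpTo I e w 0 = ∅ := by
        ext b
        simp only [lettersUpTo, Finset.mem_filter, Finset.notMem_empty, iff_false]
        rintro ⟨-, k, hk0, hk, -⟩
        omega
      rw [this]
    | succ m ih => exact fun hm => (ih (by omega)).trans (run_modulus (by omega) hβ)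
  have hinit := RegProgram.Step.read (P := alphabetProgram I e K C enc) (β := β) (w := w)
    (q := .count) (i := 0) (v := 0) (o := []) rfl
  simp only [Transducer.cellAt, Transducer.moveInput,
    show min (0 + 1) (w.length + 1) = 0 + 1 by omega] at hinit
  have h0 : (0 : AlphabetRegister d → ℕ) = onRegisters 0 0 (C * 0) := by
    funext r
    rcases r with b | b
    · rfl
    · cases b <;> rfl
  rw [h0] at hinit
  refine .trans ?_ ((run_count (by omega) 0 (by omega)).trans ((hloop _ le_rfl).trans
    (.head ?_ hout)))
  · change Run ⟨.count, 0, 0, []⟩ _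
    rw [h0]
    exact .single hinit
  -- The modulus has reached the bound, so the tested value is `-1`.
  · refine .neg rfl ?_ ?_
    · rw [linearValue_onRegisters]; simp
    · rw [linearValue_onRegisters]
      have : (1 : ℤ) ≤ 2 ^ β := one_le_pow₀ (by norm_num)
      simpa using this

/-- From `(2d+2)^n ≤ 2^((2d+2)n)` the separation lemma applies with `h = (2d+2)n`; this is why
moduli up to `2h = (4d+4)n` suffice. -/
theorem lettersUpTo_eq (w : List A) :
    (lettersUpTo I e w ((4 * d + 4) * w.length)).map e.symm.toEmbedding = reducedAlphabet I w := by
  ext a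
  rw [mem_reducedAlphabet_iff, Finset.mem_map_equiv]
  simp only [lettersUpTo, Finset.mem_filter, Finset.mem_univ, true_and, Equiv.symm_symm,
    Equiv.symm_apply_apply]
  constructor
  · rintro ⟨k, -, -, hk⟩ h
    exact hk (by simp [h])
  · intro h
    have hb := abs_position_add_one_le I w a
    have hd : Fintype.card A = d := by simpa using Fintype.card_congr e
    rw [hd] at hb
    have hw : 0 < w.length := by
      rcases w with _ | ⟨c, w⟩
      · simp [position] at h
      · simp
    obtain ⟨m, hm0, hm, hdvd⟩ := exists_not_dvd_of_lt_two_pow (h := (2 * d + 2) * w.length)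
      (by positivity) h (by
        rw [pow_mul]
        have h1 : (2 * d + 2 : ℤ) ≤ 2 ^ (2 * d + 2) := by
          exact_mod_cast (Nat.lt_two_pow_self (n := 2 * d + 2)).le
        have h2 := pow_le_pow_left₀ (by positivity) h1 w.length
        omega)
    exact ⟨m, hm0, by linarith, hdvd⟩

end Program

theorem mainTheorem6 {A : Type*} [Fintype A] (I : SimpleGraph A)
    {Ω : Type*} [Finite Ω] (enc : Finset A → List Ω) :
    (∀ g : RightAngledCoxeterGroup I,
      ∃! u : TraceMonoid I, IsCoxeterTrace u ∧ traceToCoxeter I u = g) ∧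
    LogspaceComputable (fun w : List A => enc (reducedAlphabet I w)) := by
  refine ⟨existsUnique_isCoxeterTrace I, ?_⟩
  let e := Fintype.equivFin A
  set d := Fintype.card A
  let enc' : Finset (Fin d) → List Ω := fun F => enc (F.map e.symm.toEmbedding)
  obtain ⟨K, hK⟩ : ∃ K, ∀ F, (enc' F).length ≤ K := by
    obtain ⟨K, hK⟩ := (Set.finite_range fun F => (enc' F).length).bddAbove
    exact ⟨K, fun F => hK ⟨F, rfl⟩⟩
  -- All intermediate values are at most `D * (n + 1)`, which is below `2^D * 2^(log n + 1)`; so `(D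
  -- + 1) * (log n + 1)` bits suffice.
  set D := (2 * d + 2) * (4 * d + 4) with hD
  refine (alphabetProgram I e K (4 * d + 4) enc').logspaceComputable _ (D + 1) fun w => ?_
  obtain ⟨c, hc, hhalt, hout⟩ := run_alphabetProgram (I := I) (e := e) (C := 4 * d + 4) (w := w)
    (β := (D + 1) * (Nat.log 2 w.length + 1)) hK (by
      have h1 : w.length < 2 ^ (Nat.log 2 w.length + 1) := Nat.lt_pow_succ_log_self (by norm_num) _
      have h2 : D < 2 ^ D := Nat.lt_two_pow_self
      have h3 : 2 ^ D * 2 ^ (Nat.log 2 w.length + 1) ≤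
          2 ^ ((D + 1) * (Nat.log 2 w.length + 1)) := by
        rw [← pow_add]
        refine Nat.pow_le_pow_right (by norm_num) ?_
        nlinarith
      refine lt_of_lt_of_le ?_ h3
      have h4 : (2 * d + 2) * ((4 * d + 4) * w.length + 1) ≤ D * (w.length + 1) := by
        rw [hD]; nlinarith
      exact h4.trans_lt (Nat.mul_lt_mul_of_lt_of_le h2 h1 (by positivity)))
  refine ⟨c, hc, hhalt, hout.trans ?_⟩
  change enc _ = _
  rw [lettersUpTo_eq]
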